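/- Let $\mathcal A$ be a unital $C^*$-algebra and let $\{\pi_i:\mathcal A\to \mathbf L(\mathcal H_i)\}_i$ be a family of pairwise (unitarily) inequivalent irreducible representations such that $\pi=\bigoplus_i\pi_i$, acting on the Hilbert space $\mathcal H=\bigoplus_i\mathcal H_i$, is faithful. Regard $\mathcal A$ as a subalgebra of $\mathbf L(\mathcal H)$ via $\pi$, the spatial tensor products $\mathcal A\check\otimes\mathcal A$ and $\mathcal A\check\otimes\mathcal A\check\otimes\mathcal A$ as algebras of operators on the Hilbert space tensor products $\mathcal H\bar\otimes\mathcal H$ and $\mathcal H\bar\otimes\mathcal H\bar\otimes\mathcal H$, and write $\mathcal A''=\pi(\mathcal A)''$. Let $P_\delta$ be the supremum of all projections $p\otimes p$ with $p$ a minimal projection of $\mathcal A''$, and let $\mathcal H_\delta\subseteq\mathcal H\bar\otimes\mathcal H$ be its image. Let $\rho\in\mathcal A\check\otimes\mathcal A$ be a quantum metric with respect to $\pi$, that is: (i) $\rho\ge 0$; (ii) $\rho P_\delta=P_\delta\rho=0$; (iii) $0$ is not an eigenvalue of $\rho|_{\mathcal H_\delta^\perp}\in\mathbf L(\mathcal H_\delta^\perp)$;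 (iv) $\rho$ is invariant under the flip $a\otimes b\mapsto b\otimes a$; (v) $\mathfrak M(\rho)\le\rho\otimes 1+1\otimes\rho$, where $\mathfrak M:\mathcal A\check\otimes\mathcal A\to\mathcal A\check\otimes\mathcal A\check\otimes\mathcal A$ is the $*$-morphism with $\mathfrak M(a\otimes b)=a\otimes1\otimes b$. Let $\rho^{-1}$ be the inverse of the injective operator $\rho|_{\mathcal H_\delta^\perp}$, defined on the image of $\rho|_{\mathcal H_\delta^\perp}$. For $a\in\mathcal A$ let $\|a\|_{Lip}\in[0,\infty]$ be the operator norm of $(a\otimes1-1\otimes a)\rho^{-1}$ as an operator from the image of $\rho|_{\mathcal H_\delta^\perp}$ into $\mathcal H\bar\otimes\mathcal H$, and for states $\phi,\psi$ of $\mathcal A$ let $$d(\phi,\psi)=\sup\{|\phi(a)-\psi(a)| : a\in\mathcal A,\ a^*=a,\ \|a\|_{Lip}\le1\}\in[0,\infty].$$ Let $i\ne j$, let $v\in\mathcal H_i$ and $w\in\mathcal H_j$ be unit vectors, regarded also as vectors of $\mathcal H$, and let $\phi(a)=\langle\pi_i(a)v,v\rangle$ and $\psi(a)=\langle\pi_j(a)w,w\rangle$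 be the corresponding vector states (which are pure, because $\pi_i$ and $\pi_j$ are irreducible). Then $$d(\phi,\psi)\le\|\rho(v\otimes w)\|.$$ -/

import Mathlib

open scoped TensorProduct ENNReal InnerProductSpace ComplexOrder

noncomputable section

namespace QMetric

open UniformSpace

/-! ## Hilbert space tensor products -/

section HilbertTensor

variable {E F G E' F' : Type*}
  [NormedAddCommGroup E] [InnerProductSpace ℂ E]
  [NormedAddCommGroup F] [InnerProductSpace ℂ F]
  [NormedAddCommGroup G] [InnerProductSpace ℂ G]
  [NormedAddCommGroup E'] [InnerProductSpace ℂ E']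
  [NormedAddCommGroup F'] [InnerProductSpace ℂ F']

/-- The Hilbert space tensor product: the completion of the algebraic tensor product with respect
to the inner product `⟪x ⊗ y, x' ⊗ y'⟫ = ⟪x, x'⟫ ⟪y, y'⟫`. -/
abbrev HTensor (E F : Type*) [NormedAddCommGroup E] [InnerProductSpace ℂ E]
    [NormedAddCommGroup F] [InnerProductSpace ℂ F] : Type _ :=
  Completion (E ⊗[ℂ] F)

/-- The elementary tensor `x ⊗ y`. -/
def htmul (x : E) (y : F) : HTensor E F := ((x ⊗ₜ[ℂ] y : E ⊗[ℂ] F) : Completion (E ⊗[ℂ] F))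

/-- The tensor product `S ⊗ T` of two bounded operators, acting on the Hilbert tensor product. -/
def hmap (S : E →L[ℂ] E') (T : F →L[ℂ] F') : HTensor E F →L[ℂ] HTensor E' F' :=
  (TensorProduct.mapL S T).completion

theorem hmap_htmul (S : E →L[ℂ] E') (T : F →L[ℂ] F') (x : E) (y : F) :
    hmap S T (htmul x y) = htmul (S x) (T y) := by
  simp [hmap, htmul]

/-- The flip unitary `x ⊗ y ↦ y ⊗ x`. -/
def hflip (E F : Type*) [NormedAddCommGroup E] [InnerProductSpace ℂ E]
    [NormedAddCommGroup F] [InnerProductSpace ℂ F] : HTensor E F ≃ₗᵢ[ℂ] HTensor F E :=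
  (TensorProduct.commIsometry ℂ E F).toLinearEquiv.extendOfIsometry
    (Completion.toComplₗᵢ (𝕜 := ℂ) (E := E ⊗[ℂ] F)).toLinearMap
    (Completion.toComplₗᵢ (𝕜 := ℂ) (E := F ⊗[ℂ] E)).toLinearMap
    Completion.denseRange_coe Completion.denseRange_coe (by intro x; simp)

theorem hflip_htmul (x : E) (y : F) : hflip E F (htmul x y) = htmul y x := by
  have h := LinearEquiv.extendOfIsometry_eq (f := (TensorProduct.commIsometry ℂ E F).toLinearEquiv)
    (e₁ := (Completion.toComplₗᵢ (𝕜 := ℂ) (E := E ⊗[ℂ] F)).toLinearMap)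
    (e₂ := (Completion.toComplₗᵢ (𝕜 := ℂ) (E := F ⊗[ℂ] E)).toLinearMap)
    Completion.denseRange_coe Completion.denseRange_coe (by intro x; simp) (x ⊗ₜ[ℂ] y)
  simpa [hflip, htmul] using h

theorem htmul_dense {D : Set (HTensor E F)} (hD : IsClosed D)
    (h0 : 0 ∈ D) (hadd : ∀ a ∈ D, ∀ b ∈ D, a + b ∈ D) (ht : ∀ x y, htmul x y ∈ D)
    (z : HTensor E F) : z ∈ D := by
  induction z using Completion.induction_on with
  | hp => exact hD
  | ih a =>
    induction a using TensorProduct.induction_on with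
    | zero => exact Completion.coe_zero (α := E ⊗[ℂ] F) ▸ h0
    | tmul x y => exact ht x y
    | add a b ha hb => rw [Completion.coe_add]; exact hadd _ ha _ hb

theorem continuous_htmul_left (y : F) : Continuous fun x : E => htmul x y :=
  (Completion.continuous_coe _).comp
    (((TensorProduct.mkL (𝕜 := ℂ) (E := E) (F := F)).flip y).continuous)

theorem continuous_htmul_right (x : E) : Continuous fun y : F => htmul x y :=
  (Completion.continuous_coe _).comp
    (((TensorProduct.mkL (𝕜 := ℂ) (E := E) (F := F)) x).continuous)

/-- The inclusion of `(E ⊗ F) ⊗ G` in the left bracketed triple Hilbert tensor product. -/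
def tripleLeft (E F G : Type*) [NormedAddCommGroup E] [InnerProductSpace ℂ E]
    [NormedAddCommGroup F] [InnerProductSpace ℂ F] [NormedAddCommGroup G] [InnerProductSpace ℂ G] :
    ((E ⊗[ℂ] F) ⊗[ℂ] G) →ₗᵢ[ℂ] HTensor (HTensor E F) G :=
  Completion.toComplₗᵢ.comp
    (LinearIsometry.rTensor G (Completion.toComplₗᵢ (𝕜 := ℂ) (E := E ⊗[ℂ] F)))

/-- The inclusion of `E ⊗ (F ⊗ G)` in the right bracketed triple Hilbert tensor product. -/
def tripleRight (E F G : Type*) [NormedAddCommGroup E] [InnerProductSpace ℂ E]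
    [NormedAddCommGroup F] [InnerProductSpace ℂ F] [NormedAddCommGroup G] [InnerProductSpace ℂ G] :
    (E ⊗[ℂ] (F ⊗[ℂ] G)) →ₗᵢ[ℂ] HTensor E (HTensor F G) :=
  Completion.toComplₗᵢ.comp
    (LinearIsometry.lTensor E (Completion.toComplₗᵢ (𝕜 := ℂ) (E := F ⊗[ℂ] G)))

theorem tripleLeft_tmul (x : E) (y : F) (z : G) :
    tripleLeft E F G ((x ⊗ₜ y) ⊗ₜ z) = htmul (htmul x y) z := by
  simp [tripleLeft, htmul]

theorem tripleRight_tmul (x : E) (y : F) (z : G) :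
    tripleRight E F G (x ⊗ₜ (y ⊗ₜ z)) = htmul x (htmul y z) := by
  simp [tripleRight, htmul]

theorem denseRange_tripleLeft : DenseRange (tripleLeft E F G) := by
  have hmem : ∀ a ∈ closure (Set.range (tripleLeft E F G)),
      ∀ b ∈ closure (Set.range (tripleLeft E F G)),
      a + b ∈ closure (Set.range (tripleLeft E F G)) := fun a ha b hb =>
    (LinearMap.range (tripleLeft E F G).toLinearMap).topologicalClosure.add_mem ha hb
  have h0 : (0 : HTensor (HTensor E F) G) ∈ closure (Set.range (tripleLeft E F G)) :=
    subset_closure ⟨0, LinearIsometry.map_zero _⟩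
  intro t
  refine htmul_dense isClosed_closure h0 hmem (fun u z => ?_) t
  refine htmul_dense (D := {u | htmul u z ∈ closure (Set.range (tripleLeft E F G))})
    (isClosed_closure.preimage (continuous_htmul_left z)) ?_ ?_ (fun x y => ?_) u
  · have h1 : htmul (0 : HTensor E F) z = 0 := by
      rw [htmul, TensorProduct.zero_tmul]; exact Completion.coe_zero
    change htmul (0 : HTensor E F) z ∈ closure _
    rw [h1]; exact h0
  · intro a ha b hb
    have := hmem _ ha _ hb
    simpa [htmul, TensorProduct.add_tmul, Completion.coe_add] using this
  · exact subset_closure ⟨_, tripleLeft_tmul x y z⟩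

theorem denseRange_tripleRight : DenseRange (tripleRight E F G) := by
  have hmem : ∀ a ∈ closure (Set.range (tripleRight E F G)),
      ∀ b ∈ closure (Set.range (tripleRight E F G)),
      a + b ∈ closure (Set.range (tripleRight E F G)) := fun a ha b hb =>
    (LinearMap.range (tripleRight E F G).toLinearMap).topologicalClosure.add_mem ha hb
  have h0 : (0 : HTensor E (HTensor F G)) ∈ closure (Set.range (tripleRight E F G)) :=
    subset_closure ⟨0, LinearIsometry.map_zero _⟩
  intro t
  refine htmul_dense isClosed_closure h0 hmem (fun x u => ?_) t
  refine htmul_dense (D := {u | htmul x u ∈ closure (Set.range (tripleRight E F G))})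
    (isClosed_closure.preimage (continuous_htmul_right x)) ?_ ?_ (fun y z => ?_) u
  · have h1 : htmul x (0 : HTensor F G) = 0 := by
      rw [htmul, TensorProduct.tmul_zero]; exact Completion.coe_zero
    change htmul x (0 : HTensor F G) ∈ closure _
    rw [h1]; exact h0
  · intro a ha b hb
    have := hmem _ ha _ hb
    simpa [htmul, TensorProduct.tmul_add, Completion.coe_add] using this
  · exact subset_closure ⟨_, tripleRight_tmul x y z⟩

/-- The associativity unitary `(x ⊗ y) ⊗ z ↦ x ⊗ (y ⊗ z)`. -/
def hassoc (E F G : Type*) [NormedAddCommGroup E] [InnerProductSpace ℂ E]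
    [NormedAddCommGroup F] [InnerProductSpace ℂ F] [NormedAddCommGroup G] [InnerProductSpace ℂ G] :
    HTensor (HTensor E F) G ≃ₗᵢ[ℂ] HTensor E (HTensor F G) :=
  (TensorProduct.assocIsometry ℂ E F G).toLinearEquiv.extendOfIsometry
    (tripleLeft E F G).toLinearMap (tripleRight E F G).toLinearMap
    denseRange_tripleLeft denseRange_tripleRight (by intro x; simp)

theorem hassoc_htmul (x : E) (y : F) (z : G) :
    hassoc E F G (htmul (htmul x y) z) = htmul x (htmul y z) := by
  have h := LinearEquiv.extendOfIsometry_eq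
    (f := (TensorProduct.assocIsometry ℂ E F G).toLinearEquiv)
    (e₁ := (tripleLeft E F G).toLinearMap) (e₂ := (tripleRight E F G).toLinearMap)
    denseRange_tripleLeft denseRange_tripleRight (by intro x; simp) ((x ⊗ₜ y) ⊗ₜ z)
  simpa [hassoc, tripleLeft_tmul, tripleRight_tmul] using h

/-- The flip of operators `S ⊗ T ↦ T ⊗ S` on `L(E ⊗ E)`, implemented by the flip unitary. -/
def opFlip (X : HTensor E E →L[ℂ] HTensor E E) : HTensor E E →L[ℂ] HTensor E E :=
  (hflip E E : HTensor E E →L[ℂ] HTensor E E) ∘L X ∘L (hflip E E : HTensor E E →L[ℂ] HTensor E E)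

/-- `X ⊗ 1` on `E ⊗ E ⊗ E`. -/
def leg12 (X : HTensor E E →L[ℂ] HTensor E E) :
    HTensor (HTensor E E) E →L[ℂ] HTensor (HTensor E E) E :=
  hmap X (ContinuousLinearMap.id ℂ E)

/-- `1 ⊗ X` on `E ⊗ E ⊗ E`. -/
def leg23 (X : HTensor E E →L[ℂ] HTensor E E) :
    HTensor (HTensor E E) E →L[ℂ] HTensor (HTensor E E) E :=
  ((hassoc E E E).symm : HTensor E (HTensor E E) →L[ℂ] HTensor (HTensor E E) E) ∘L
    hmap (ContinuousLinearMap.id ℂ E) X ∘L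
    (hassoc E E E : HTensor (HTensor E E) E →L[ℂ] HTensor E (HTensor E E))

/-- The map `S ⊗ T ↦ S ⊗ 1 ⊗ T` putting `1` in the mid position: conjugation of `X ⊗ 1` by the
unitary that exchanges the last two tensor factors. -/
def leg13 (X : HTensor E E →L[ℂ] HTensor E E) :
    HTensor (HTensor E E) E →L[ℂ] HTensor (HTensor E E) E :=
  leg23 (hflip E E : HTensor E E →L[ℂ] HTensor E E) ∘L leg12 X ∘L
    leg23 (hflip E E : HTensor E E →L[ℂ] HTensor E E)

theorem ext_htmul {S T : HTensor E F →L[ℂ] G} (h : ∀ x y, S (htmul x y) = T (htmul x y)) :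
    S = T := by
  ext z
  refine htmul_dense (D := {z | S z = T z}) (isClosed_eq S.continuous T.continuous) (by simp)
    ?_ h z
  intro a ha b hb
  simp only [Set.mem_ofPred_eq] at ha hb ⊢
  rw [map_add, map_add, ha, hb]

theorem opFlip_hmap (S T : E →L[ℂ] E) : opFlip (hmap S T) = hmap T S :=
  ext_htmul fun x y => by simp [opFlip, hflip_htmul, hmap_htmul]

theorem leg12_apply (S T : E →L[ℂ] E) (x y z : E) :
    leg12 (hmap S T) (htmul (htmul x y) z) = htmul (htmul (S x) (T y)) z := by
  simp [leg12, hmap_htmul]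

theorem hassoc_symm_htmul (x : E) (y : F) (z : G) :
    (hassoc E F G).symm (htmul x (htmul y z)) = htmul (htmul x y) z := by
  rw [← hassoc_htmul, LinearIsometryEquiv.symm_apply_apply]

theorem leg23_apply (S T : E →L[ℂ] E) (x y z : E) :
    leg23 (hmap S T) (htmul (htmul x y) z) = htmul (htmul x (S y)) (T z) := by
  simp [leg23, hmap_htmul, hassoc_htmul, hassoc_symm_htmul]

theorem leg13_apply (S T : E →L[ℂ] E) (x y z : E) :
    leg13 (hmap S T) (htmul (htmul x y) z) = htmul (htmul (S x) y) (T z) := by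
  simp [leg13, leg12, leg23, hmap_htmul, hassoc_htmul, hassoc_symm_htmul, hflip_htmul]

end HilbertTensor

/-! ## Atomic representations -/

section Representations

variable {A : Type*} [CStarAlgebra A]

/-- A (topologically) irreducible representation: the space is nonzero and the only closed
invariant subspaces are the trivial ones. -/
def IsIrreducibleRep {K : Type*} [NormedAddCommGroup K] [InnerProductSpace ℂ K] [CompleteSpace K]
    (σ : A →⋆ₐ[ℂ] (K →L[ℂ] K)) : Prop :=
  Nontrivial K ∧ ∀ M : Submodule ℂ K, IsClosed (M : Set K) →
    (∀ a, ∀ x ∈ M, σ a x ∈ M) → M = ⊥ ∨ M = ⊤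

/-- Unitary equivalence of representations. -/
def EquivReps {K L : Type*} [NormedAddCommGroup K] [InnerProductSpace ℂ K] [CompleteSpace K]
    [NormedAddCommGroup L] [InnerProductSpace ℂ L] [CompleteSpace L]
    (σ : A →⋆ₐ[ℂ] (K →L[ℂ] K)) (τ : A →⋆ₐ[ℂ] (L →L[ℂ] L)) : Prop :=
  ∃ U : K ≃ₗᵢ[ℂ] L, ∀ a x, U (σ a x) = τ a (U x)

variable {ι : Type*} {H : ι → Type*} [∀ i, NormedAddCommGroup (H i)]
  [∀ i, InnerProductSpace ℂ (H i)] [∀ i, CompleteSpace (H i)]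

/-- The Hilbert space direct sum `⊕ Hᵢ`. -/
abbrev HSum (H : ι → Type*) [∀ i, NormedAddCommGroup (H i)] : Type _ := lp H 2

theorem norm_rep_le (π : ∀ i, A →⋆ₐ[ℂ] (H i →L[ℂ] H i)) (a : A) (x : HSum H) (i : ι) :
    ‖π i a (x i)‖ ≤ ‖(((‖a‖ : ℂ) • x : HSum H) : ∀ i, H i) i‖ := by
  have h : ‖π i a‖ ≤ ‖a‖ := NonUnitalStarAlgHom.norm_apply_le (π i) a
  refine ((π i a).le_opNorm (x i)).trans ?_
  simp only [lp.coeFn_smul, Pi.smul_apply, norm_smul, Complex.norm_real, norm_norm]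
  gcongr

theorem memℓp_rep (π : ∀ i, A →⋆ₐ[ℂ] (H i →L[ℂ] H i)) (a : A) (x : HSum H) :
    Memℓp (fun i => π i a (x i)) 2 :=
  (lp.memℓp ((‖a‖ : ℂ) • x)).mono' (norm_rep_le π a x)

/-- The operator `⊕ πᵢ(a)` on `⊕ Hᵢ`. -/
def sumOp (π : ∀ i, A →⋆ₐ[ℂ] (H i →L[ℂ] H i)) (a : A) : HSum H →L[ℂ] HSum H :=
  LinearMap.mkContinuous
    { toFun := fun x => ⟨fun i => π i a (x i), memℓp_rep π a x⟩
      map_add' := fun x y => by ext i; exact (π i a).map_add (x i) (y i)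
      map_smul' := fun c x => by ext i; simp } ‖a‖ (fun x => by
        have h := lp.norm_mono (p := 2) two_ne_zero
          (x := (⟨fun i => π i a (x i), memℓp_rep π a x⟩ : HSum H))
          (y := ((‖a‖ : ℂ) • x : HSum H)) (norm_rep_le π a x)
        rwa [norm_smul, Complex.norm_real, norm_norm] at h)

@[simp]
theorem sumOp_apply (π : ∀ i, A →⋆ₐ[ℂ] (H i →L[ℂ] H i)) (a : A) (x : HSum H) (i : ι) :
    sumOp π a x i = π i a (x i) := rfl

/-- The direct sum representation `π = ⊕ πᵢ` on `⊕ Hᵢ`. -/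
def sumRep (π : ∀ i, A →⋆ₐ[ℂ] (H i →L[ℂ] H i)) : A →⋆ₐ[ℂ] (HSum H →L[ℂ] HSum H) where
  toFun := sumOp π
  map_one' := by ext x i; simp
  map_mul' a b := by ext x i; simp
  map_zero' := by ext x i; simp
  map_add' a b := by ext x i; simp
  commutes' c := by ext x i; simp [Algebra.algebraMap_eq_smul_one]
  map_star' a := by
    rw [ContinuousLinearMap.star_eq_adjoint, ContinuousLinearMap.eq_adjoint_iff]
    intro x y
    rw [lp.inner_eq_tsum, lp.inner_eq_tsum]
    refine tsum_congr fun i => ?_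
    simp [map_star, ContinuousLinearMap.star_eq_adjoint, ContinuousLinearMap.adjoint_inner_left]

@[simp]
theorem sumRep_apply (π : ∀ i, A →⋆ₐ[ℂ] (H i →L[ℂ] H i)) (a : A) (x : HSum H) (i : ι) :
    sumRep π a x i = π i a (x i) := rfl

/-- `⊕ πᵢ` is a faithful atomic representation: the `πᵢ` are irreducible and pairwise
inequivalent, and their direct sum is injective. -/
structure IsFaithfulAtomic (π : ∀ i, A →⋆ₐ[ℂ] (H i →L[ℂ] H i)) : Prop where
  irreducible : ∀ i, IsIrreducibleRep (π i)
  inequivalent : ∀ i j, i ≠ j → ¬ EquivReps (π i) (π j)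
  faithful : Function.Injective (sumRep π)

/-! ## Quantum metrics -/

/-- The bounded operators on `H ⊗ H` where `H = ⊕ Hᵢ`. -/
abbrev PairOp (H : ι → Type*) [∀ i, NormedAddCommGroup (H i)] [∀ i, InnerProductSpace ℂ (H i)] :
    Type _ :=
  HTensor (HSum H) (HSum H) →L[ℂ] HTensor (HSum H) (HSum H)

/-- The spatial tensor product of `A` with itself, realised on `H ⊗ H` by means of `π = ⊕ πᵢ`: the
norm closure of the linear span of the operators `π(a) ⊗ π(b)`. -/
def spatialTensor (π : ∀ i, A →⋆ₐ[ℂ] (H i →L[ℂ] H i)) : Submodule ℂ (PairOp H) :=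
  (Submodule.span ℂ
    (Set.range fun p : A × A => (hmap (sumRep π p.1) (sumRep π p.2) : PairOp H))).topologicalClosure

/-- The enveloping von Neumann algebra `A'' = π(A)''`, as a set of operators on `H`. -/
def doubleCommutant (π : ∀ i, A →⋆ₐ[ℂ] (H i →L[ℂ] H i)) : Set (HSum H →L[ℂ] HSum H) :=
  Set.centralizer (Set.centralizer (Set.range (sumRep π)))

/-- Minimal projections of `A''`. -/
def IsMinimalProj (π : ∀ i, A →⋆ₐ[ℂ] (H i →L[ℂ] H i)) (p : HSum H →L[ℂ] HSum H) : Prop :=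
  p ∈ doubleCommutant π ∧ IsStarProjection p ∧ p ≠ 0 ∧
    ∀ q ∈ doubleCommutant π, IsStarProjection q → q ≤ p → q = 0 ∨ q = p

/-- `H_δ`: the closed linear span of the ranges of the projections `p ⊗ p` with `p` a minimal
projection of `A''`. -/
def diagSpace (π : ∀ i, A →⋆ₐ[ℂ] (H i →L[ℂ] H i)) :
    Submodule ℂ (HTensor (HSum H) (HSum H)) :=
  (⨆ (p : HSum H →L[ℂ] HSum H) (_ : IsMinimalProj π p),
    LinearMap.range (hmap p p : PairOp H).toLinearMap).topologicalClosure

instance (π : ∀ i, A →⋆ₐ[ℂ] (H i →L[ℂ] H i)) : (diagSpace π).HasOrthogonalProjection := by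
  unfold diagSpace
  infer_instance

/-- `P_δ`, the characteristic function of the diagonal: the supremum of the projections `p ⊗ p`
with `p` a minimal projection of `A''`, that is, the orthogonal projection onto `H_δ`. -/
def diagProj (π : ∀ i, A →⋆ₐ[ℂ] (H i →L[ℂ] H i)) : PairOp H :=
  (diagSpace π).starProjection

theorem isStarProjection_hmap {E : Type*} [NormedAddCommGroup E] [InnerProductSpace ℂ E]
    [CompleteSpace E] {p : E →L[ℂ] E} (hp : IsStarProjection p) :
    IsStarProjection (hmap p p) := by
  refine ⟨?_, ?_⟩
  · refine ext_htmul fun x y => ?_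
    have h : ∀ x, p (p x) = p x := fun x => congrArg (fun T => T x) hp.isIdempotentElem
    simp [hmap_htmul, h]
  · rw [ContinuousLinearMap.isSelfAdjoint_iff', eq_comm, ContinuousLinearMap.eq_adjoint_iff]
    intro z w
    have hs : ∀ x y, ⟪p x, y⟫_ℂ = ⟪x, p y⟫_ℂ := by
      intro x y
      conv_lhs => rw [← hp.isSelfAdjoint.star_eq]
      rw [ContinuousLinearMap.star_eq_adjoint, ContinuousLinearMap.adjoint_inner_left]
    refine htmul_dense (D := {z | ⟪hmap p p z, w⟫_ℂ = ⟪z, hmap p p w⟫_ℂ})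
      (isClosed_eq (by fun_prop) (by fun_prop)) (by simp) ?_ (fun x y => ?_) z
    · intro a ha b hb
      simp only [Set.mem_ofPred_eq, map_add, inner_add_left] at ha hb ⊢
      rw [ha, hb]
    refine htmul_dense (D := {w | ⟪hmap p p (htmul x y), w⟫_ℂ = ⟪htmul x y, hmap p p w⟫_ℂ})
      (isClosed_eq (by fun_prop) (by fun_prop)) (by simp) ?_ (fun x' y' => ?_) w
    · intro a ha b hb
      simp only [Set.mem_ofPred_eq, map_add, inner_add_right] at ha hb ⊢
      rw [ha, hb]
    rw [Set.mem_ofPred_eq, hmap_htmul, hmap_htmul]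
    simp [htmul, hs]

/-- `P_δ` is the least upper bound, among all projections, of the projections `p ⊗ p` with `p` a
minimal projection of `A''`. -/
theorem diagProj_le_iff (π : ∀ i, A →⋆ₐ[ℂ] (H i →L[ℂ] H i)) (Q : PairOp H)
    (hQ : IsStarProjection Q) :
    diagProj π ≤ Q ↔ ∀ p, IsMinimalProj π p → (hmap p p : PairOp H) ≤ Q := by
  obtain ⟨K, hK, rfl⟩ := isStarProjection_iff_eq_starProjection.mp hQ
  have key : ∀ p, IsMinimalProj π p → ((hmap p p : PairOp H) ≤ K.starProjection ↔
      LinearMap.range (hmap p p : PairOp H).toLinearMap ≤ K) := by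
    intro p hp
    obtain ⟨h1, h2⟩ := isStarProjection_iff_eq_starProjection_range.mp
      (isStarProjection_hmap hp.2.1)
    conv_lhs => rw [h2]
    exact Submodule.starProjection_le_starProjection_iff
  have hKc : IsClosed (K : Set (HTensor (HSum H) (HSum H))) := by
    rw [← Submodule.orthogonal_orthogonal K]
    exact Submodule.isClosed_orthogonal _
  unfold diagProj
  rw [Submodule.starProjection_le_starProjection_iff, diagSpace]
  constructor
  · intro h p hp
    rw [key p hp]
    exact (le_iSup₂_of_le p hp le_rfl).trans ((Submodule.le_topologicalClosure _).trans h)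
  · intro h
    exact Submodule.topologicalClosure_minimal _ (iSup₂_le fun p hp => (key p hp).1 (h p hp)) hKc

/-- Quantum metrics with respect to `π = ⊕ πᵢ`. -/
structure IsQuantumMetric (π : ∀ i, A →⋆ₐ[ℂ] (H i →L[ℂ] H i)) (ρ : PairOp H) : Prop where
  mem_tensor : ρ ∈ spatialTensor π
  nonneg : 0 ≤ ρ
  flip_eq : opFlip ρ = ρ
  triangle : leg13 ρ ≤ leg12 ρ + leg23 ρ
  mul_diagProj : ρ * diagProj π = 0
  diagProj_mul : diagProj π * ρ = 0
  /-- `0` is not an eigenvalue of the restriction of `ρ` to the orthogonal complement of `H_δ`. -/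
  not_eigenvalue : ∀ ξ ∈ (diagSpace π)ᗮ, ρ ξ = 0 → ξ = 0

/-! ## The Lipschitz seminorm and the Monge-Kantorovich semimetric -/

/-- The restriction of `ρ` to the orthogonal complement of `H_δ`. -/
def offDiag (π : ∀ i, A →⋆ₐ[ℂ] (H i →L[ℂ] H i)) (ρ : PairOp H) :
    (diagSpace π)ᗮ →ₗ[ℂ] HTensor (HSum H) (HSum H) :=
  ρ.toLinearMap.domRestrict (diagSpace π)ᗮ

theorem IsQuantumMetric.offDiag_injective {π : ∀ i, A →⋆ₐ[ℂ] (H i →L[ℂ] H i)} {ρ : PairOp H}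
    (hρ : IsQuantumMetric π ρ) : Function.Injective (offDiag π ρ) := by
  rw [injective_iff_map_eq_zero]
  intro ξ hξ
  exact Subtype.ext (hρ.not_eigenvalue ξ ξ.2 hξ)

/-- `ρ⁻¹`, the inverse of the restriction of `ρ` to the orthogonal complement of `H_δ`, defined on
the image of that restriction. -/
def rhoInv {π : ∀ i, A →⋆ₐ[ℂ] (H i →L[ℂ] H i)} {ρ : PairOp H} (hρ : IsQuantumMetric π ρ) :
    LinearMap.range (offDiag π ρ) →ₗ[ℂ] HTensor (HSum H) (HSum H) :=
  (diagSpace π)ᗮ.subtype ∘ₗ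
    (LinearEquiv.ofInjective (offDiag π ρ) hρ.offDiag_injective).symm.toLinearMap

/-- The operator norm, possibly infinite, of a linear map that need not be bounded. -/
def extOpNorm {E F : Type*} [SeminormedAddCommGroup E] [Module ℂ E]
    [SeminormedAddCommGroup F] [Module ℂ F] (T : E →ₗ[ℂ] F) : ℝ≥0∞ :=
  ⨆ (x : E) (_ : ‖x‖ ≤ 1), ‖T x‖ₑ

/-- The operator `a ⊗ 1 - 1 ⊗ a` on `H ⊗ H`. -/
def commOp (π : ∀ i, A →⋆ₐ[ℂ] (H i →L[ℂ] H i)) (a : A) : PairOp H :=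
  hmap (sumRep π a) (ContinuousLinearMap.id ℂ (HSum H)) -
    hmap (ContinuousLinearMap.id ℂ (HSum H)) (sumRep π a)

/-- The Lipschitz seminorm `‖a‖_Lip = ‖(a ⊗ 1 - 1 ⊗ a) ρ⁻¹‖ ∈ [0, ∞]`. -/
def lipNorm {π : ∀ i, A →⋆ₐ[ℂ] (H i →L[ℂ] H i)} {ρ : PairOp H} (hρ : IsQuantumMetric π ρ)
    (a : A) : ℝ≥0∞ :=
  extOpNorm ((commOp π a).toLinearMap ∘ₗ rhoInv hρ)

variable (A) in
/-- States of a unital C⋆-algebra: positive linear functionals taking the value `1` at `1`. -/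
structure CState where
  toLin : A →ₗ[ℂ] ℂ
  nonneg : ∀ a, 0 ≤ toLin (star a * a)
  map_one : toLin 1 = 1

/-- The Monge-Kantorovich semimetric on the state space, with values in `[0, ∞]`. -/
def mkDist {π : ∀ i, A →⋆ₐ[ℂ] (H i →L[ℂ] H i)} {ρ : PairOp H} (hρ : IsQuantumMetric π ρ)
    (φ ψ : CState A) : ℝ≥0∞ :=
  ⨆ (a : A) (_ : star a = a) (_ : lipNorm hρ a ≤ 1), ‖φ.toLin a - ψ.toLin a‖ₑ

/-- The vector state `a ↦ ⟨σ(a) v, v⟩` of a unit vector `v`. (Mathlib's inner product is conjugate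
linear in its first argument.) -/
def vectorState {K : Type*} [NormedAddCommGroup K] [InnerProductSpace ℂ K] [CompleteSpace K]
    (σ : A →⋆ₐ[ℂ] (K →L[ℂ] K)) (v : K) (hv : ‖v‖ = 1) : CState A where
  toLin :=
    { toFun := fun a => ⟪v, σ a v⟫_ℂ
      map_add' := fun a b => by simp
      map_smul' := fun c a => by simp }
  nonneg a := by
    have h : ⟪v, σ (star a * a) v⟫_ℂ = ⟪σ a v, σ a v⟫_ℂ := by
      rw [map_mul, map_star, ContinuousLinearMap.star_eq_adjoint, mul_apply_eq_comp,
        ContinuousLinearMap.adjoint_inner_right]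
    change (0 : ℂ) ≤ ⟪v, σ (star a * a) v⟫_ℂ
    rw [h, inner_self_eq_norm_sq_to_K, ← RCLike.ofReal_pow]
    exact Complex.zero_le_real.2 (sq_nonneg _)
  map_one := by
    change ⟪v, σ 1 v⟫_ℂ = 1
    simp [inner_self_eq_norm_sq_to_K, hv]

open Classical in
/-- The vector `v ∈ Hᵢ` regarded as an element of `⊕ Hᵢ`. -/
def incl (i : ι) (v : H i) : HSum H := lp.single 2 i v

end Representations

end QMetric

end

/-! Put `ξ = v ⊗ w`. Since `v` and `w` are unit vectors, `⟪ξ, (a ⊗ 1 - 1 ⊗ a) ξ⟫ = φ(a) - ψ(a)`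
(`inner_commOp_htmul_incl`), so by Cauchy-Schwarz the difference is at most `‖(a ⊗ 1 - 1 ⊗ a) ξ‖`.
If `ξ` is orthogonal to `H_δ`, then `ξ = ρ⁻¹(ρ ξ)`, and `‖a‖_Lip ≤ 1` bounds this norm by `‖ρ ξ‖`
(`norm_commOp_le_of_lipNorm_le_one`).

The substance is the orthogonality, `htmul_incl_mem_diagSpace_orthogonal`. By Schur's lemma and
inequivalence, the commutant of `π(A)` preserves every block `H k`, so the block projections lie in
`A''`. They also commute with `A''`, so minimality confines a minimal projection `p` to a single
block. As `i ≠ j`, `p` kills `v` or `w`, whence `(p ⊗ p) ξ = 0`. -/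

noncomputable section

namespace QMetric

/-! ### Schur's lemma for irreducible representations. -/

section Schur

variable {A : Type*} [CStarAlgebra A]
  {K : Type*} [NormedAddCommGroup K] [InnerProductSpace ℂ K] [CompleteSpace K]
  {L : Type*} [NormedAddCommGroup L] [InnerProductSpace ℂ L] [CompleteSpace L]

/-- In the commutant of an irreducible representation a product vanishes only if a factor does. -/
theorem IsIrreducibleRep.eq_zero_or_eq_zero_of_mul_eq_zero {σ : A →⋆ₐ[ℂ] (K →L[ℂ] K)}
    (hσ : IsIrreducibleRep σ) {S T : K →L[ℂ] K} (hS : ∀ a, Commute S (σ a)) (h : S * T = 0) :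
    S = 0 ∨ T = 0 := by
  rcases hσ.2 (LinearMap.ker S.toLinearMap) S.isClosed_ker (fun a x hx => by
    have h1 : S (σ a x) = σ a (S x) := congrArg (fun R => R x) (hS a).eq
    have h2 : S x = 0 := hx
    change S (σ a x) = 0
    rw [h1, h2, map_zero]) with hM | hM
  · right
    ext x
    have h1 : S (T x) = 0 := congrArg (fun R => R x) h
    have hx : T x ∈ LinearMap.ker S.toLinearMap := h1
    rw [hM] at hx
    exact hx
  · left
    ext x
    have hx : x ∈ LinearMap.ker S.toLinearMap := hM ▸ Submodule.mem_top
    exact hx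

/-- **Schur's lemma**: the self-adjoint elements of the commutant of an irreducible representation
are scalars. -/
theorem IsIrreducibleRep.exists_eq_smul_one {σ : A →⋆ₐ[ℂ] (K →L[ℂ] K)}
    (hσ : IsIrreducibleRep σ) {T : K →L[ℂ] K} (hT : IsSelfAdjoint T)
    (hc : ∀ a, Commute T (σ a)) : ∃ c : ℝ, T = algebraMap ℝ (K →L[ℂ] K) c := by
  have hle : ∀ s ∈ spectrum ℝ T, ∀ t ∈ spectrum ℝ T, ¬ s < t := by
    intro s hs t ht hst
    -- Two points of the spectrum are separated at their midpoint: the positive parts of `x - m` and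
    -- `m - x` have product zero, yet the former is positive at `t` and the latter at `s`.
    set m : ℝ := (s + t) / 2 with hm
    have hprod : cfc (fun x : ℝ => max (x - m) 0) T * cfc (fun x : ℝ => max (m - x) 0) T = 0 := by
      rw [← cfc_mul _ _ T (by fun_prop) (by fun_prop), ← cfc_const_zero ℝ T]
      refine cfc_congr fun x _ => ?_
      rcases le_total x m with h | h
      · simp [max_eq_right (sub_nonpos.2 h)]
      · simp [max_eq_right (sub_nonpos.2 h)]
    rcases hσ.eq_zero_or_eq_zero_of_mul_eq_zero (fun a => (hc a).cfc_real _) hprod with h | h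
    · rw [← cfc_const_zero ℝ T] at h
      have h1 : max (t - m) 0 = 0 := eqOn_of_cfc_eq_cfc h (by fun_prop) (by fun_prop) hT ht
      have h2 := le_max_left (t - m) 0
      linarith
    · rw [← cfc_const_zero ℝ T] at h
      have h1 : max (m - s) 0 = 0 := eqOn_of_cfc_eq_cfc h (by fun_prop) (by fun_prop) hT hs
      have h2 := le_max_left (m - s) 0
      linarith
  obtain ⟨c, hc⟩ : ∃ c : ℝ, ∀ s ∈ spectrum ℝ T, s = c := by
    rcases (spectrum ℝ T).eq_empty_or_nonempty with h | ⟨c, hc⟩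
    · exact ⟨0, by simp [h]⟩
    · exact ⟨c, fun s hs => le_antisymm (not_lt.1 (hle c hc s hs)) (not_lt.1 (hle s hs c hc))⟩
  refine ⟨c, ?_⟩
  rw [← cfc_const c T, ← cfc_id' ℝ T]
  -- The previous rewrite also replaced the `T` inside the constant's functional calculus; this
  -- restores it.
  conv_rhs => rw [cfc_id' ℝ T]
  exact cfc_congr fun s hs => hc s hs

/-- A nonzero bounded intertwiner of irreducible representations makes them equivalent. -/
theorem IsIrreducibleRep.eq_zero_of_not_equivReps {σ : A →⋆ₐ[ℂ] (K →L[ℂ] K)}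
    {τ : A →⋆ₐ[ℂ] (L →L[ℂ] L)} (hσ : IsIrreducibleRep σ) (hτ : IsIrreducibleRep τ)
    (hne : ¬ EquivReps σ τ) (T : K →L[ℂ] L) (hT : ∀ a x, T (σ a x) = τ a (T x)) : T = 0 := by
  by_contra hT0
  have hadj : ∀ a y, T.adjoint (τ a y) = σ a (T.adjoint y) := by
    intro a y
    refine ext_inner_right ℂ fun x => ?_
    have h1 : σ a = (σ (star a)).adjoint := by
      rw [map_star, ContinuousLinearMap.star_eq_adjoint, ContinuousLinearMap.adjoint_adjoint]
    have h2 : τ a = (τ (star a)).adjoint := by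
      rw [map_star, ContinuousLinearMap.star_eq_adjoint, ContinuousLinearMap.adjoint_adjoint]
    rw [h1, h2]
    simp only [ContinuousLinearMap.adjoint_inner_left, hT]
  -- The adjoint intertwines in the opposite direction, so `T* T` lies in the commutant of `σ` and
  -- is a scalar `c`; then `T / √c` is isometric.
  obtain ⟨c, hc⟩ := hσ.exists_eq_smul_one (T := T.adjoint ∘L T)
    (by
      rw [ContinuousLinearMap.isSelfAdjoint_iff', ContinuousLinearMap.adjoint_comp,
        ContinuousLinearMap.adjoint_adjoint])
    (fun a => by
      ext x
      simp [hT, hadj])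
  have hnorm : ∀ x, ‖T x‖ ^ 2 = c * ‖x‖ ^ 2 := by
    intro x
    have h1 : T.adjoint (T x) = (c : ℂ) • x := by
      have := congrArg (fun R => R x) hc
      simpa [Algebra.algebraMap_eq_smul_one] using this
    have h2 : ⟪T x, T x⟫_ℂ = (c : ℂ) * ⟪x, x⟫_ℂ := by
      rw [← ContinuousLinearMap.adjoint_inner_right, h1, inner_smul_right]
    rw [inner_self_eq_norm_sq_to_K, inner_self_eq_norm_sq_to_K] at h2
    apply Complex.ofReal_injective
    push_cast
    exact h2
  have hcpos : 0 < c := by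
    obtain ⟨x, hx⟩ : ∃ x, T x ≠ 0 := by
      by_contra! h
      exact hT0 (ContinuousLinearMap.ext h)
    have h1 : 0 < ‖T x‖ ^ 2 := by positivity
    rw [hnorm x] at h1
    exact pos_of_mul_pos_left h1 (by positivity)
  have hs : 0 < Real.sqrt c := Real.sqrt_pos.2 hcpos
  let V : K →ₗᵢ[ℂ] L :=
    { toLinearMap := ((((Real.sqrt c)⁻¹ : ℝ) : ℂ) • T).toLinearMap
      norm_map' := fun x => by
        have h1 : ‖T x‖ = Real.sqrt c * ‖x‖ := by
          rw [← Real.sqrt_sq (norm_nonneg (T x)), hnorm x, Real.sqrt_mul hcpos.le,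
            Real.sqrt_sq (norm_nonneg x)]
        change ‖(((Real.sqrt c)⁻¹ : ℝ) : ℂ) • T x‖ = ‖x‖
        rw [norm_smul, h1, Complex.norm_real, norm_inv, Real.norm_of_nonneg hs.le,
          inv_mul_cancel_left₀ hs.ne'] }
  have hV : ∀ a x, V (σ a x) = τ a (V x) := by
    intro a x
    change (((Real.sqrt c)⁻¹ : ℝ) : ℂ) • T (σ a x) = τ a ((((Real.sqrt c)⁻¹ : ℝ) : ℂ) • T x)
    rw [map_smul, hT]
  -- The range of an isometry from a complete space is closed. Here it is also invariant under `τ`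
  -- and nonzero, hence everything.
  have hsurj : Function.Surjective V := by
    rcases hτ.2 (LinearMap.range V.toLinearMap) V.isometry.isClosedEmbedding.isClosed_range (by
      rintro a _ ⟨x, rfl⟩
      exact ⟨σ a x, hV a x⟩) with h | h
    · exfalso
      have := hσ.1
      obtain ⟨x, hx⟩ := exists_ne (0 : K)
      have h1 : V x ∈ LinearMap.range V.toLinearMap := ⟨x, rfl⟩
      rw [h, Submodule.mem_bot] at h1
      exact hx (V.injective (h1.trans V.map_zero.symm))
    · exact LinearMap.range_eq_top.1 h
  exact hne ⟨LinearIsometryEquiv.ofSurjective V hsurj, hV⟩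

end Schur

/-! ### Block projections, minimal projections and the complement of the diagonal. -/

section Blocks

variable {ι : Type*} {H : ι → Type*} [∀ i, NormedAddCommGroup (H i)]

theorem incl_apply_self (i : ι) (v : H i) : incl i v i = v := by
  classical
  exact Pi.single_eq_same i v

theorem incl_apply_of_ne {i k : ι} (h : k ≠ i) (v : H i) : incl i v k = 0 := by
  classical
  exact Pi.single_eq_of_ne h v

theorem norm_incl (i : ι) (v : H i) : ‖incl i v‖ = ‖v‖ := by
  classical
  exact lp.norm_single (by norm_num) i v

variable [∀ i, InnerProductSpace ℂ (H i)]

open Classical in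
/-- The inclusion of `Hᵢ` in `⊕ Hᵢ`, as a bounded operator. -/
def inclL (H : ι → Type*) [∀ i, NormedAddCommGroup (H i)] [∀ i, InnerProductSpace ℂ (H i)]
    (i : ι) : H i →L[ℂ] HSum H :=
  lp.singleContinuousLinearMap ℂ H 2 i

/-- The projection of `⊕ Hᵢ` onto the block `Hᵢ`, as an operator on `⊕ Hᵢ`. -/
def blockProj (H : ι → Type*) [∀ i, NormedAddCommGroup (H i)] [∀ i, InnerProductSpace ℂ (H i)]
    (i : ι) : HSum H →L[ℂ] HSum H :=
  inclL H i ∘L lp.evalCLM ℂ H 2 i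

theorem blockProj_apply (i : ι) (x : HSum H) : blockProj H i x = incl i (x i) := rfl

theorem incl_zero (i : ι) : incl i (0 : H i) = 0 := (inclL H i).map_zero

theorem ext_incl {F : Type*} [NormedAddCommGroup F] [InnerProductSpace ℂ F]
    {S T : HSum H →L[ℂ] F} (h : ∀ i v, S (incl i v) = T (incl i v)) : S = T := by
  classical
  refine lp.ext_continuousLinearMap (by norm_num) fun i => ?_
  ext v
  exact h i v

theorem inner_incl_left (i : ι) (v : H i) (x : HSum H) : ⟪incl i v, x⟫_ℂ = ⟪v, x i⟫_ℂ := by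
  classical
  exact lp.inner_single_left (𝕜 := ℂ) i v x

theorem inner_incl_right (i : ι) (v : H i) (x : HSum H) : ⟪x, incl i v⟫_ℂ = ⟪x i, v⟫_ℂ := by
  rw [← inner_conj_symm, inner_incl_left, inner_conj_symm]

variable {A : Type*} [CStarAlgebra A] [∀ i, CompleteSpace (H i)]

theorem sumRep_incl (π : ∀ i, A →⋆ₐ[ℂ] (H i →L[ℂ] H i)) (a : A) (i : ι) (v : H i) :
    sumRep π a (incl i v) = incl i (π i a v) := by
  ext k
  rw [sumRep_apply]
  by_cases h : k = i
  · subst h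
    rw [incl_apply_self, incl_apply_self]
  · rw [incl_apply_of_ne h, incl_apply_of_ne h, map_zero]

theorem isStarProjection_blockProj (i : ι) : IsStarProjection (blockProj H i) := by
  refine ⟨?_, ?_⟩
  · ext1 x
    change blockProj H i (blockProj H i x) = blockProj H i x
    rw [blockProj_apply, blockProj_apply, incl_apply_self]
  · rw [ContinuousLinearMap.isSelfAdjoint_iff', eq_comm, ContinuousLinearMap.eq_adjoint_iff]
    intro x y
    rw [blockProj_apply, blockProj_apply, inner_incl_left, inner_incl_right]

/-- Ensures that block projections commute with everything in `A''`. -/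
theorem blockProj_mem_centralizer (π : ∀ i, A →⋆ₐ[ℂ] (H i →L[ℂ] H i)) (k : ι) :
    blockProj H k ∈ Set.centralizer (Set.range (sumRep π)) := by
  rintro _ ⟨a, rfl⟩
  ext1 x
  change sumRep π a (blockProj H k x) = blockProj H k (sumRep π a x)
  rw [blockProj_apply, blockProj_apply, sumRep_incl, sumRep_apply]

/-- Operators commuting with a direct sum of pairwise inequivalent irreducible representations map
each block to itself. -/
theorem IsFaithfulAtomic.apply_incl_apply_of_ne {π : ∀ i, A →⋆ₐ[ℂ] (H i →L[ℂ] H i)}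
    (hπ : IsFaithfulAtomic π) {S : HSum H →L[ℂ] HSum H}
    (hS : S ∈ Set.centralizer (Set.range (sumRep π))) {k l : ι} (hkl : k ≠ l) (v : H k) :
    S (incl k v) l = 0 := by
  -- The matrix entry of `S` from block `k` to block `l` intertwines `π k` and `π l`.
  have h := (hπ.irreducible k).eq_zero_of_not_equivReps (hπ.irreducible l)
    (hπ.inequivalent k l hkl) (lp.evalCLM ℂ H 2 l ∘L S ∘L inclL H k) (fun a x => by
      change S (incl k (π k a x)) l = π l a (S (incl k x) l)
      have h1 : sumRep π a (S (incl k x)) = S (sumRep π a (incl k x)) :=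
        congrArg (fun R => R (incl k x)) (hS (sumRep π a) ⟨a, rfl⟩)
      rw [← sumRep_incl, ← h1, sumRep_apply])
  exact congrArg (fun R => R v) h

/-- An operator of the commutant has no off-diagonal entries, so it commutes with each block
projection. -/
theorem IsFaithfulAtomic.blockProj_mem_doubleCommutant {π : ∀ i, A →⋆ₐ[ℂ] (H i →L[ℂ] H i)}
    (hπ : IsFaithfulAtomic π) (k : ι) : blockProj H k ∈ doubleCommutant π := by
  intro S hS
  refine ext_incl fun l v => ?_
  change S (blockProj H k (incl l v)) = blockProj H k (S (incl l v))
  rw [blockProj_apply, blockProj_apply]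
  by_cases h : k = l
  · subst h
    rw [incl_apply_self]
    ext m
    by_cases hm : m = k
    · subst hm
      rw [incl_apply_self]
    · rw [incl_apply_of_ne hm, hπ.apply_incl_apply_of_ne hS (Ne.symm hm)]
  · rw [incl_apply_of_ne h, hπ.apply_incl_apply_of_ne hS (Ne.symm h), incl_zero, map_zero]

/-- A minimal projection of `A''` is supported on a single block. -/
theorem IsMinimalProj.exists_mul_blockProj_eq {π : ∀ i, A →⋆ₐ[ℂ] (H i →L[ℂ] H i)}
    (hπ : IsFaithfulAtomic π) {p : HSum H →L[ℂ] HSum H} (hp : IsMinimalProj π p) :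
    ∃ k, p * blockProj H k = p := by
  obtain ⟨hmem, hproj, hne, hmin⟩ := hp
  obtain ⟨k, hk⟩ : ∃ k, p * blockProj H k ≠ 0 := by
    by_contra! h
    refine hne (ext_incl fun k v => ?_)
    have h1 : p (blockProj H k (incl k v)) = 0 := congrArg (fun R => R (incl k v)) (h k)
    rwa [blockProj_apply, incl_apply_self] at h1
  have hcomm : Commute p (blockProj H k) := (hmem _ (blockProj_mem_centralizer π k)).symm
  have hq : IsStarProjection (p * blockProj H k) := hproj.mul (isStarProjection_blockProj k) hcomm
  -- The product is a nonzero projection of `A''` below `p`, so minimality forces it to equal `p`.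
  refine ⟨k, (hmin _ (Set.mul_mem_centralizer hmem (hπ.blockProj_mem_doubleCommutant k)) hq
    ?_).resolve_left hk⟩
  rw [hq.le_iff_mul_eq_right hproj, ← mul_assoc, hproj.isIdempotentElem.eq]

/-- The one block that supports `p` cannot be both `i` and `j`. -/
theorem IsMinimalProj.apply_incl_eq_zero_or {π : ∀ i, A →⋆ₐ[ℂ] (H i →L[ℂ] H i)}
    (hπ : IsFaithfulAtomic π) {p : HSum H →L[ℂ] HSum H} (hp : IsMinimalProj π p)
    {i j : ι} (hij : i ≠ j) (v : H i) (w : H j) : p (incl i v) = 0 ∨ p (incl j w) = 0 := by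
  obtain ⟨k, hk⟩ := hp.exists_mul_blockProj_eq hπ
  have key : ∀ l, l ≠ k → ∀ u : H l, p (incl l u) = 0 := by
    intro l hl u
    rw [← hk]
    change p (blockProj H k (incl l u)) = 0
    rw [blockProj_apply, incl_apply_of_ne (Ne.symm hl), incl_zero, map_zero]
  by_cases h : i = k
  · exact Or.inr (key j (fun h' => hij (h.trans h'.symm)) w)
  · exact Or.inl (key i h v)

theorem inner_htmul {E F : Type*} [NormedAddCommGroup E] [InnerProductSpace ℂ E]
    [NormedAddCommGroup F] [InnerProductSpace ℂ F] (x x' : E) (y y' : F) :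
    ⟪htmul x y, htmul x' y'⟫_ℂ = ⟪x, x'⟫_ℂ * ⟪y, y'⟫_ℂ := by
  simp [htmul]

theorem norm_htmul {E F : Type*} [NormedAddCommGroup E] [InnerProductSpace ℂ E]
    [NormedAddCommGroup F] [InnerProductSpace ℂ F] (x : E) (y : F) :
    ‖htmul x y‖ = ‖x‖ * ‖y‖ := by
  simp [htmul]

/-- Elementary tensors of vectors in distinct blocks are orthogonal to the diagonal. -/
theorem IsFaithfulAtomic.htmul_incl_mem_diagSpace_orthogonal
    {π : ∀ i, A →⋆ₐ[ℂ] (H i →L[ℂ] H i)} (hπ : IsFaithfulAtomic π) {i j : ι} (hij : i ≠ j)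
    (v : H i) (w : H j) : htmul (incl i v) (incl j w) ∈ (diagSpace π)ᗮ := by
  set ξ := htmul (incl i v) (incl j w) with hξ
  -- The complement of `ξ` is closed, so it suffices to treat the range of each `p ⊗ p`;
  -- self-adjointness then moves `p ⊗ p` onto `ξ`.
  have hle : diagSpace π ≤ (ℂ ∙ ξ)ᗮ := by
    refine Submodule.topologicalClosure_minimal _ (iSup₂_le fun p hp => ?_)
      (Submodule.isClosed_orthogonal _)
    rintro _ ⟨z, rfl⟩
    rw [Submodule.mem_orthogonal_singleton_iff_inner_left]
    have hz : (hmap p p : PairOp H) ξ = 0 := by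
      rw [hξ, hmap_htmul, ← norm_eq_zero, norm_htmul]
      rcases hp.apply_incl_eq_zero_or hπ hij v w with h | h <;> simp [h]
    have hsa := ContinuousLinearMap.isSelfAdjoint_iff'.1
      (isStarProjection_hmap hp.2.1).isSelfAdjoint
    change ⟪(hmap p p : PairOp H) z, ξ⟫_ℂ = 0
    rw [← hsa, ContinuousLinearMap.adjoint_inner_left, hz, inner_zero_right]
  rw [Submodule.mem_orthogonal]
  intro u hu
  exact Submodule.mem_orthogonal_singleton_iff_inner_left.1 (hle hu)

end Blocks

/-! ### From the Lipschitz seminorm to the difference of states. -/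

section Lipschitz

theorem norm_apply_le_of_extOpNorm_le_one {E F : Type*} [NormedAddCommGroup E] [NormedSpace ℂ E]
    [NormedAddCommGroup F] [NormedSpace ℂ F] {T : E →ₗ[ℂ] F} (hT : extOpNorm T ≤ 1) (x : E) :
    ‖T x‖ ≤ ‖x‖ := by
  by_cases hx : x = 0
  · simp [hx]
  have hx' : 0 < ‖x‖ := norm_pos_iff.2 hx
  have hle : ∀ y : E, ‖y‖ ≤ 1 → ‖T y‖ ≤ 1 := by
    intro y hy
    have h1 : ‖T y‖ₑ ≤ 1 := (le_iSup₂ (f := fun (x : E) (_ : ‖x‖ ≤ 1) => ‖T x‖ₑ) y hy).trans hT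
    rwa [← ofReal_norm, ENNReal.ofReal_le_one] at h1
  have h := hle (((‖x‖⁻¹ : ℝ) : ℂ) • x) (by
    rw [norm_smul, Complex.norm_real, norm_inv, norm_norm, inv_mul_cancel₀ hx'.ne'])
  rwa [map_smul, norm_smul, Complex.norm_real, norm_inv, norm_norm, inv_mul_le_iff₀ hx',
    mul_one] at h

variable {A : Type*} [CStarAlgebra A] {ι : Type*} {H : ι → Type*} [∀ i, NormedAddCommGroup (H i)]
  [∀ i, InnerProductSpace ℂ (H i)] [∀ i, CompleteSpace (H i)]

/-- The operator `(a ⊗ 1 - 1 ⊗ a) ρ⁻¹` is tested at `ρ ξ`, which lies in its domain and which `ρ⁻¹`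
sends back to `ξ`. -/
theorem norm_commOp_le_of_lipNorm_le_one {π : ∀ i, A →⋆ₐ[ℂ] (H i →L[ℂ] H i)} {ρ : PairOp H}
    (hρ : IsQuantumMetric π ρ) {a : A} (ha : lipNorm hρ a ≤ 1)
    {ξ : HTensor (HSum H) (HSum H)} (hξ : ξ ∈ (diagSpace π)ᗮ) : ‖commOp π a ξ‖ ≤ ‖ρ ξ‖ := by
  have h := norm_apply_le_of_extOpNorm_le_one ha
    (LinearEquiv.ofInjective (offDiag π ρ) hρ.offDiag_injective ⟨ξ, hξ⟩)
  simp only [rhoInv, LinearMap.comp_apply, LinearEquiv.coe_coe, LinearEquiv.symm_apply_apply] at h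
  exact h

theorem inner_commOp_htmul_incl (π : ∀ i, A →⋆ₐ[ℂ] (H i →L[ℂ] H i)) (a : A) {i j : ι}
    {v : H i} {w : H j} (hv : ‖v‖ = 1) (hw : ‖w‖ = 1) :
    ⟪htmul (incl i v) (incl j w), commOp π a (htmul (incl i v) (incl j w))⟫_ℂ =
      (vectorState (π i) v hv).toLin a - (vectorState (π j) w hw).toLin a := by
  change ⟪_, (hmap _ _ : PairOp H) _ - (hmap _ _ : PairOp H) _⟫_ℂ = ⟪v, π i a v⟫_ℂ - ⟪w, π j a w⟫_ℂ
  simp only [inner_sub_right, hmap_htmul, inner_htmul, sumRep_incl, inner_incl_left,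
    incl_apply_self, ContinuousLinearMap.id_apply]
  simp [inner_self_eq_norm_sq_to_K, hv, hw]

end Lipschitz

end QMetric

end

theorem mainTheorem7 {A : Type*} [CStarAlgebra A] {ι : Type*} {H : ι → Type*}
    [∀ i, NormedAddCommGroup (H i)] [∀ i, InnerProductSpace ℂ (H i)] [∀ i, CompleteSpace (H i)]
    (π : ∀ i, A →⋆ₐ[ℂ] (H i →L[ℂ] H i)) (hπ : QMetric.IsFaithfulAtomic π)
    (ρ : QMetric.PairOp H) (hρ : QMetric.IsQuantumMetric π ρ)
    (i j : ι) (hij : i ≠ j) (v : H i) (w : H j) (hv : ‖v‖ = 1) (hw : ‖w‖ = 1) :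
    QMetric.mkDist hρ (QMetric.vectorState (π i) v hv) (QMetric.vectorState (π j) w hw) ≤
      ENNReal.ofReal ‖ρ (QMetric.htmul (QMetric.incl i v) (QMetric.incl j w))‖ := by
  refine iSup_le fun a => iSup_le fun _ => iSup_le fun ha => ?_
  rw [← ofReal_norm, ← QMetric.inner_commOp_htmul_incl π a hv hw]
  refine ENNReal.ofReal_le_ofReal ((norm_inner_le_norm _ _).trans ?_)
  rw [QMetric.norm_htmul, QMetric.norm_incl, QMetric.norm_incl, hv, hw, one_mul, one_mul]
  exact QMetric.norm_commOp_le_of_lipNorm_le_one hρ ha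
    (hπ.htmul_incl_mem_diagSpace_orthogonal hij v w)
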